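/- Let $q$ be a prime power, let $V$ be a vector space of finite dimension $n$ over the finite field $\mathbb{F}_q$, and let $\mathrm{Bil}(V)$ be the $\mathbb{F}_q$-vector space of all bilinear forms $f : V\times V\to \mathbb{F}_q$. For $f\in \mathrm{Bil}(V)$ define the rank of $f$ by $\operatorname{rank} f=\dim V-\dim\{u\in V : f(u,w)=0 \text{ for all } w\in V\}$. Let $r$ be an integer with $0<r<n$ and suppose that $q\geq r+1$. Let $\mathcal{M}$ be a subspace of $\mathrm{Bil}(V)$ of dimension $2n$ such that every non-zero element of $\mathcal{M}$ has rank $r$ or $n$. Then $n-r$ divides $n$, and the number of elements of rank $r$ in $\mathcal{M}$ is \[ \frac{(q^n-1)^2}{q^{n-r}-1}. \] -/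

import Mathlib

/-- The left radical `{u | ∀ w, f u w = 0}` of a bilinear form `f` on `V × V`. -/
def radL {F V : Type*} [Field F] [AddCommGroup V] [Module F V]
    (f : LinearMap.BilinForm F V) : Submodule F V where
  carrier := {u | ∀ w, f u w = 0}
  add_mem' := by
    intro a b ha hb w
    simp [ha w, hb w]
  zero_mem' := by
    intro w
    simp
  smul_mem' := by
    intro c a ha w
    simp [ha w]

/-- The rank `dim V - dim rad_L f` of a bilinear form on a finite-dimensional space
(the natural-number subtraction never truncates there). -/
noncomputable def bilRank {F V : Type*} [Field F] [AddCommGroup V] [Module F V]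
    (f : LinearMap.BilinForm F V) : ℕ :=
  Module.finrank F V - Module.finrank F (radL f)

/-!
Let `q` be the order of `F`, let `n` and `w` be the dimensions of `V` and `W`, and regard a space
`E` of linear maps `V → W` as a bilinear map `B : E × V → W`. Counting the pairs of non-zero
`e`, `u` with `B e u = 0` in two ways gives
`∑_u (q ^ dim ker B(·, u) - 1) = ∑_e (q ^ dim ker B(e, ·) - 1)`.

Suppose first that all non-zero `e` have the same rank `r < q`. If `dim E > w`, every `u` is killed
by some `e ≠ 0`; since the maps `x e + e'` have rank at most `r` for all scalars `x`, every `e'`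
maps `u` into the range of `e`, so the kernel of `B(·, u)` has codimension at most `r`. The double
count then forces `dim E ≤ n`.

Now allow the ranks `r` and `n`, with `n ≤ w` and `dim E ≥ 2 w`. For `u ≠ 0` the maps killing `u`
are not injective, so they form a space of constant rank `r`, of dimension at most `w` by the first
part and at least `w` by rank-nullity. Every summand of the double count is now known.
-/

open Module

section Rank

variable {F V W : Type*} [Field F] [AddCommGroup V] [Module F V] [AddCommGroup W] [Module F W]

theorem exists_notMem_spectrum_of_finrank_lt_card [FiniteDimensional F V] (h : End F V)
    {s : Finset F} (hs : finrank F V < s.card) : ∃ x ∈ s, x ∉ spectrum F h := by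
  by_contra! hspec
  refine h.charpoly_monic.ne_zero
    (Polynomial.eq_zero_of_natDegree_lt_card_of_eval_eq_zero' _ s (fun x hx => ?_) ?_)
  · exact (End.mem_spectrum_iff_isRoot_charpoly h x).1 (hspec x hx)
  · rwa [h.charpoly_natDegree]

theorem exists_projection_range_apply_eq_zero (f : V →ₗ[F] W) {w : W}
    (hw : w ∉ LinearMap.range f) :
    ∃ p : W →ₗ[F] LinearMap.range f, (∀ y : LinearMap.range f, p y = y) ∧ p w = 0 := by
  have hw0 : w ≠ 0 := fun h => hw (h ▸ zero_mem _)
  obtain ⟨C, hwC, hC⟩ :=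
    ((Submodule.disjoint_span_singleton' hw0).2 hw).symm.exists_isCompl
  refine ⟨(LinearMap.range f).projectionOnto C hC.symm,
    Submodule.projectionOnto_apply_left hC.symm, ?_⟩
  exact (Submodule.projectionOnto_apply_eq_zero_iff hC.symm).2
    (hwC (Submodule.mem_span_singleton_self w))

theorem finrank_lt_of_map_eq_top {p : V →ₗ[F] W} {S : Submodule F V} [FiniteDimensional F S]
    (hS : S.map p = ⊤) {w : V} (hwS : w ∈ S) (hw0 : w ≠ 0) (hpw : p w = 0) :
    finrank F W < finrank F S := by
  have hker : LinearMap.ker (p.domRestrict S) ≠ ⊥ := fun hbot =>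
    hw0 (congrArg Subtype.val (LinearMap.ker_eq_bot'.1 hbot ⟨w, hwS⟩ hpw))
  have hpos := Submodule.one_le_finrank_iff.2 hker
  have hnullity := (p.domRestrict S).finrank_range_add_finrank_ker
  rw [LinearMap.range_domRestrict, hS, finrank_top] at hnullity
  lia

theorem apply_mem_range_of_finrank_range_smul_add_le [FiniteDimensional F W] {f g : V →ₗ[F] W}
    {s : Finset F} (hs : finrank F (LinearMap.range f) < s.card)
    (hfg : ∀ x ∈ s, finrank F (LinearMap.range (x • f + g)) ≤ finrank F (LinearMap.range f))
    {u : V} (hu : f u = 0) : g u ∈ LinearMap.range f := by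
  -- Otherwise compress to `range f` by a projection `p` killing `g u` and a section `i` of `f`:
  -- `x • f + g` becomes `x - h`, which is invertible for some `x ∈ s` as `s` is larger than the
  -- spectrum of `h`. Then `range (x • f + g)` maps onto `range f`, with `g u` in the kernel.
  by_contra hgu
  obtain ⟨p, hp, hpu⟩ := exists_projection_range_apply_eq_zero f hgu
  obtain ⟨i, hi⟩ := f.rangeRestrict.exists_rightInverse_of_surjective f.range_rangeRestrict
  obtain ⟨x, hxs, hx⟩ := exists_notMem_spectrum_of_finrank_lt_card (-(p ∘ₗ g ∘ₗ i)) hs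
  have hcomp : p ∘ₗ (x • f + g) ∘ₗ i = algebraMap F (End F (LinearMap.range f)) x -
      -(p ∘ₗ g ∘ₗ i) := by
    ext y
    have hy : f (i y) = y := congrArg Subtype.val (LinearMap.congr_fun hi y)
    simp [hy, hp]
  have hsurj : Function.Surjective (p ∘ₗ (x • f + g) ∘ₗ i) :=
    hcomp ▸ ((End.isUnit_iff _).1 (spectrum.notMem_iff.1 hx)).surjective
  have hmap : (LinearMap.range (x • f + g)).map p = ⊤ := by
    refine eq_top_iff.2 fun y _ => ?_
    obtain ⟨z, hz⟩ := hsurj y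
    exact ⟨_, ⟨i z, rfl⟩, hz⟩
  refine (hfg x hxs).not_gt (finrank_lt_of_map_eq_top hmap (w := g u) ⟨u, by simp [hu]⟩ ?_ hpu)
  exact fun hgu0 => hgu (hgu0 ▸ zero_mem _)

theorem injective_of_finrank_range_eq [FiniteDimensional F V] {f : V →ₗ[F] W}
    (hf : finrank F (LinearMap.range f) = finrank F V) : Function.Injective f := by
  have := f.finrank_range_add_finrank_ker
  exact LinearMap.ker_eq_bot.1 (Submodule.finrank_eq_zero.1 (by lia))

end Rank

section Counting

variable {F E V W : Type*} [Field F] [AddCommGroup E] [Module F E]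
  [AddCommGroup V] [Module F V] [AddCommGroup W] [Module F W]

theorem card_filter_mem_compl_zero [Fintype V] [DecidableEq V] (S : Submodule F V)
    [DecidablePred (· ∈ S)] :
    (Finset.filter (· ∈ S) {0}ᶜ).card = Nat.card F ^ finrank F S - 1 := by
  have herase : Finset.filter (· ∈ S) {0}ᶜ = (Finset.univ.filter (· ∈ S)).erase 0 := by
    ext
    simp [and_comm]
  rw [herase, Finset.card_erase_of_mem (by simp), ← natCard_eq_pow_finrank, ← Fintype.card_subtype,
    Nat.card_eq_fintype_card]

variable (F) in
theorem card_compl_zero [Fintype V] [DecidableEq V] :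
    ({0}ᶜ : Finset V).card = Nat.card F ^ finrank F V - 1 := by
  rw [Finset.card_compl, Finset.card_singleton, ← natCard_eq_pow_finrank, Nat.card_eq_fintype_card]

theorem sum_card_pow_finrank_ker_flip [Fintype E] [Fintype V] [DecidableEq E] [DecidableEq V]
    (B : E →ₗ[F] V →ₗ[F] W) :
    ∑ u ∈ ({0}ᶜ : Finset V), (Nat.card F ^ finrank F (LinearMap.ker (B.flip u)) - 1) =
      ∑ e ∈ ({0}ᶜ : Finset E), (Nat.card F ^ finrank F (LinearMap.ker (B e)) - 1) := by
  classical
  simp only [← card_filter_mem_compl_zero, LinearMap.mem_ker, LinearMap.flip_apply]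
  exact Finset.sum_card_bipartiteAbove_eq_sum_card_bipartiteBelow fun u e => B e u = 0

end Counting

section Arithmetic

theorem le_of_pow_sub_one_mul_pow_sub_one_le {q r a b : ℕ} (hq : 1 < q) (hr : 0 < r)
    (h : (q ^ (a + r) - 1) * (q ^ b - 1) ≤ (q ^ (b + r) - 1) * (q ^ a - 1)) : b ≤ a := by
  by_contra! hab
  have hqr : 1 < q ^ r := one_lt_pow₀ hq hr.ne'
  have hqab : q ^ a < q ^ b := Nat.pow_lt_pow_right hq hab
  have hpos : ∀ k, 1 ≤ q ^ k := fun k => Nat.one_le_pow k q (by lia)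
  zify [hpos] at h hqr hqab
  rw [pow_add, pow_add] at h
  nlinarith [mul_pos (sub_pos.2 hqab) (sub_pos.2 hqr)]

theorem dvd_or_dvd_of_pow_sub_one_dvd_mul {q m a b : ℕ} (hq : 1 < q) (hm : 0 < m)
    (h : q ^ m - 1 ∣ (q ^ a - 1) * (q ^ b - 1)) : m ∣ a ∨ m ∣ b := by
  -- `a` and `b` may be replaced by their gcds with `m`; if these are proper divisors of `m`, they
  -- are at most `m / 2` and the product is too small.
  have hgcd : q ^ m - 1 ∣ (q ^ m.gcd a - 1) * (q ^ m.gcd b - 1) := by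
    rw [← Nat.pow_sub_one_gcd_pow_sub_one, ← Nat.pow_sub_one_gcd_pow_sub_one]
    exact (Nat.dvd_gcd dvd_rfl h).trans (Nat.gcd_mul_right_dvd_mul_gcd _ _ _)
  have hpow_gcd : ∀ c, 1 < q ^ m.gcd c := fun c =>
    one_lt_pow₀ hq (Nat.gcd_pos_of_pos_left c hm).ne'
  have hpow_sq : ∀ c, ¬ m ∣ c → (q ^ m.gcd c) ^ 2 ≤ q ^ m := by
    intro c hc
    rw [← pow_mul]
    refine Nat.pow_le_pow_right (by lia) ?_
    obtain ⟨k, hk⟩ := Nat.gcd_dvd_left m c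
    have hk2 : 2 ≤ k := by
      by_contra! hk1
      interval_cases k
      · lia
      · exact hc (Nat.gcd_eq_left_iff_dvd.1 (by lia))
    calc m.gcd c * 2 ≤ m.gcd c * k := Nat.mul_le_mul_left _ hk2
      _ = m := hk.symm
  by_contra! hab
  have ha := hpow_gcd a
  have hb := hpow_gcd b
  have hle := Nat.le_of_dvd (Nat.mul_pos (by lia) (by lia)) hgcd
  have ha2 := hpow_sq a hab.1
  have hb2 := hpow_sq b hab.2
  have hm1 : 1 ≤ q ^ m := Nat.one_le_pow m q (by lia)
  zify [ha.le, hb.le, hm1] at *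
  nlinarith [sq_nonneg ((q : ℤ) ^ m.gcd a - q ^ m.gcd b)]

end Arithmetic

section RankSpaces

variable {F E V W : Type*} [Field F] [Finite F] [AddCommGroup E] [Module F E]
  [FiniteDimensional F E] [AddCommGroup V] [Module F V] [FiniteDimensional F V]
  [AddCommGroup W] [Module F W] [FiniteDimensional F W] {B : E →ₗ[F] V →ₗ[F] W} {r : ℕ}

theorem finrank_range_flip_le_of_constant_rank (hr : r < Nat.card F)
    (hB : ∀ e ≠ 0, finrank F (LinearMap.range (B e)) = r) (hE : finrank F W < finrank F E) (u : V) :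
    finrank F (LinearMap.range (B.flip u)) ≤ r := by
  have := Fintype.ofFinite F
  obtain ⟨e, heu, he⟩ := Submodule.exists_mem_ne_zero_of_ne_bot
    (LinearMap.ker_ne_bot_of_finrank_lt (f := B.flip u) hE)
  have hrank_le : ∀ e', finrank F (LinearMap.range (B e')) ≤ r := by
    intro e'
    rcases eq_or_ne e' 0 with rfl | he'
    · rw [map_zero, LinearMap.range_zero, finrank_bot]
      exact r.zero_le
    · exact (hB e' he').le
  rw [← hB e he]
  refine Submodule.finrank_mono ?_
  rintro _ ⟨e', rfl⟩
  refine apply_mem_range_of_finrank_range_smul_add_le (s := Finset.univ) (u := u) ?_ ?_ heu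
  · rwa [hB e he, Finset.card_univ, ← Nat.card_eq_fintype_card]
  · intro x _
    rw [hB e he, ← map_smul, ← map_add]
    exact hrank_le _

theorem finrank_le_max_of_constant_rank (hr0 : 0 < r) (hr : r < Nat.card F)
    (hB : ∀ e ≠ 0, finrank F (LinearMap.range (B e)) = r) :
    finrank F E ≤ max (finrank F V) (finrank F W) := by
  classical
  have : Finite E := finite_of_finite F
  have : Finite V := finite_of_finite F
  have := Fintype.ofFinite E
  have := Fintype.ofFinite V
  rw [le_max_iff, or_iff_not_imp_right, not_le]
  intro hE
  have : Nontrivial E := nontrivial_of_finrank_pos (R := F) (by lia)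
  obtain ⟨e, he⟩ := exists_ne (0 : E)
  have hrV : r ≤ finrank F V := hB e he ▸ (B e).finrank_range_le
  have hrE : r ≤ finrank F E := (hB e he ▸ (LinearMap.range (B e)).finrank_le).trans hE.le
  have hker : ∀ e ∈ ({0}ᶜ : Finset E), finrank F (LinearMap.ker (B e)) = finrank F V - r := by
    intro e he
    have := (B e).finrank_range_add_finrank_ker
    rw [hB e (by simpa using he)] at this
    lia
  have hker_flip : ∀ u : V, finrank F E - r ≤ finrank F (LinearMap.ker (B.flip u)) := by
    intro u
    have := (B.flip u).finrank_range_add_finrank_ker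
    have := finrank_range_flip_le_of_constant_rank hr hB hE u
    lia
  have hcount :=
    calc (Nat.card F ^ finrank F V - 1) * (Nat.card F ^ (finrank F E - r) - 1)
      _ ≤ ∑ u ∈ ({0}ᶜ : Finset V), (Nat.card F ^ finrank F (LinearMap.ker (B.flip u)) - 1) := by
        rw [← card_compl_zero F, ← smul_eq_mul]
        refine Finset.card_nsmul_le_sum _ _ _ fun u _ => Nat.sub_le_sub_right ?_ 1
        exact Nat.pow_le_pow_right Nat.card_pos (hker_flip u)
      _ = ∑ e ∈ ({0}ᶜ : Finset E), (Nat.card F ^ finrank F (LinearMap.ker (B e)) - 1) :=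
        sum_card_pow_finrank_ker_flip B
      _ = (Nat.card F ^ finrank F E - 1) * (Nat.card F ^ (finrank F V - r) - 1) := by
        rw [Finset.sum_congr rfl fun e he => by rw [hker e he], Finset.sum_const, card_compl_zero F,
          smul_eq_mul]
  obtain ⟨a, ha⟩ := Nat.exists_eq_add_of_le' hrV
  obtain ⟨b, hb⟩ := Nat.exists_eq_add_of_le' hrE
  rw [ha, hb, Nat.add_sub_cancel, Nat.add_sub_cancel] at hcount
  have := le_of_pow_sub_one_mul_pow_sub_one_le Finite.one_lt_card hr0 hcount
  lia

theorem finrank_ker_flip_of_rank_eq_or_injective (hr0 : 0 < r) (hr : r < Nat.card F)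
    (hVW : finrank F V ≤ finrank F W) (hE : 2 * finrank F W ≤ finrank F E)
    (hB : ∀ e ≠ 0, finrank F (LinearMap.range (B e)) = r ∨ Function.Injective (B e))
    {u : V} (hu : u ≠ 0) : finrank F (LinearMap.ker (B.flip u)) = finrank F W := by
  apply le_antisymm
  · have hconst : ∀ e ≠ 0, finrank F (LinearMap.range
        (B.domRestrict (LinearMap.ker (B.flip u)) e)) = r := by
      rintro ⟨e, heu⟩ he
      refine (hB e (by simpa using he)).resolve_right fun hinj => hu (hinj ?_)
      rw [map_zero]
      exact heu
    simpa [hVW] using finrank_le_max_of_constant_rank hr0 hr hconst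
  · have := (B.flip u).finrank_range_add_finrank_ker
    have := (LinearMap.range (B.flip u)).finrank_le
    lia

theorem ncard_rank_eq_mul_of_rank_eq_or_injective (hr0 : 0 < r) (hr : r < Nat.card F)
    (hVW : finrank F V ≤ finrank F W) (hE : 2 * finrank F W ≤ finrank F E)
    (hB : ∀ e ≠ 0, finrank F (LinearMap.range (B e)) = r ∨ Function.Injective (B e)) :
    {e | finrank F (LinearMap.range (B e)) = r}.ncard * (Nat.card F ^ (finrank F V - r) - 1) =
      (Nat.card F ^ finrank F V - 1) * (Nat.card F ^ finrank F W - 1) := by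
  classical
  have : Finite E := finite_of_finite F
  have : Finite V := finite_of_finite F
  have := Fintype.ofFinite E
  have := Fintype.ofFinite V
  have hterm : ∀ e ∈ ({0}ᶜ : Finset E), Nat.card F ^ finrank F (LinearMap.ker (B e)) - 1 =
      if finrank F (LinearMap.range (B e)) = r then Nat.card F ^ (finrank F V - r) - 1 else 0 := by
    intro e he
    split_ifs with hrank
    · rw [← (B e).finrank_range_add_finrank_ker, hrank, Nat.add_sub_cancel_left]
    · have hinj := (hB e (by simpa using he)).resolve_left hrank
      rw [LinearMap.ker_eq_bot.2 hinj, finrank_bot, pow_zero, Nat.sub_self]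
  have hset : {e | finrank F (LinearMap.range (B e)) = r} =
      (({0}ᶜ : Finset E).filter fun e => finrank F (LinearMap.range (B e)) = r : Set E) := by
    ext e
    rcases eq_or_ne e 0 with rfl | he
    · have hzero : finrank F (LinearMap.range (B 0)) = 0 := by
        rw [map_zero, LinearMap.range_zero, finrank_bot]
      simp [hzero, hr0.ne]
    · simp [he]
  symm
  calc (Nat.card F ^ finrank F V - 1) * (Nat.card F ^ finrank F W - 1)
    _ = ∑ u ∈ ({0}ᶜ : Finset V), (Nat.card F ^ finrank F (LinearMap.ker (B.flip u)) - 1) := by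
      rw [Finset.sum_congr rfl fun u hu => by
        rw [finrank_ker_flip_of_rank_eq_or_injective hr0 hr hVW hE hB (by simpa using hu)],
        Finset.sum_const, card_compl_zero F, smul_eq_mul]
    _ = ∑ e ∈ ({0}ᶜ : Finset E), (Nat.card F ^ finrank F (LinearMap.ker (B e)) - 1) :=
      sum_card_pow_finrank_ker_flip B
    _ = {e | finrank F (LinearMap.range (B e)) = r}.ncard *
        (Nat.card F ^ (finrank F V - r) - 1) := by
      rw [Finset.sum_congr rfl hterm, ← Finset.sum_filter, Finset.sum_const, smul_eq_mul, hset,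
        Set.ncard_coe_finset]

end RankSpaces

theorem mainTheorem2_general {F V W : Type*} [Field F] [Finite F]
    [AddCommGroup V] [Module F V] [FiniteDimensional F V]
    [AddCommGroup W] [Module F W] [FiniteDimensional F W]
    (q n w r : ℕ) (hq : Nat.card F = q) (hn : finrank F V = n) (hw : finrank F W = w)
    (hnw : n ≤ w) (hr0 : 0 < r) (hrn : r < n) (hqr : r + 1 ≤ q)
    (M : Submodule F (V →ₗ[F] W)) (hM : 2 * w ≤ finrank F M)
    (hrank : ∀ f ∈ M, f ≠ 0 →
      finrank F (LinearMap.range f) = r ∨ finrank F (LinearMap.range f) = n) :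
    (n - r ∣ n ∨ n - r ∣ w) ∧
      (Set.ncard {f : V →ₗ[F] W | f ∈ M ∧ finrank F (LinearMap.range f) = r} : ℚ) =
        ((q : ℚ) ^ n - 1) * ((q : ℚ) ^ w - 1) / ((q : ℚ) ^ (n - r) - 1) := by
  subst hq hn hw
  have hq1 : 1 < Nat.card F := Finite.one_lt_card
  have hinj : ∀ f : M, f ≠ 0 →
      finrank F (LinearMap.range (M.subtype f)) = r ∨ Function.Injective (M.subtype f) := by
    intro f hf
    exact (hrank f f.2 (by simpa using hf)).imp_right injective_of_finrank_range_eq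
  have hcount := ncard_rank_eq_mul_of_rank_eq_or_injective hr0 hqr hnw hM hinj
  have himage : {f | f ∈ M ∧ finrank F (LinearMap.range f) = r} =
      M.subtype '' {f | finrank F (LinearMap.range (M.subtype f)) = r} := by
    ext f
    exact ⟨fun ⟨hfM, hf⟩ => ⟨⟨f, hfM⟩, hf, rfl⟩, fun ⟨g, hg, hgf⟩ => hgf ▸ ⟨g.2, hg⟩⟩
  rw [← Set.ncard_image_of_injective _ M.subtype_injective, ← himage] at hcount
  refine ⟨dvd_or_dvd_of_pow_sub_one_dvd_mul hq1 (by lia) (Dvd.intro_left _ hcount), ?_⟩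
  have hone_lt : (1 : ℚ) < (Nat.card F : ℚ) ^ (finrank F V - r) :=
    one_lt_pow₀ (by exact_mod_cast hq1) (by lia)
  have hpos : ∀ k, 1 ≤ Nat.card F ^ k := fun k => Nat.one_le_pow k _ Nat.card_pos
  rw [eq_div_iff (sub_pos.2 hone_lt).ne']
  have := congrArg (Nat.cast : ℕ → ℚ) hcount
  push_cast [hpos] at this
  exact this

theorem radL_eq_ker {F V : Type*} [Field F] [AddCommGroup V] [Module F V]
    (f : LinearMap.BilinForm F V) : radL f = LinearMap.ker f := by
  ext u
  rw [LinearMap.mem_ker, LinearMap.ext_iff]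
  rfl

theorem bilRank_eq_finrank_range {F V : Type*} [Field F] [AddCommGroup V] [Module F V]
    [FiniteDimensional F V] (f : LinearMap.BilinForm F V) :
    bilRank f = finrank F (LinearMap.range f) := by
  rw [bilRank, radL_eq_ker, ← f.finrank_range_add_finrank_ker, Nat.add_sub_cancel]

theorem mainTheorem2 {F V : Type*} [Field F] [Finite F]
    [AddCommGroup V] [Module F V] [FiniteDimensional F V]
    (q n r : ℕ) (hq : Nat.card F = q) (hn : Module.finrank F V = n)
    (hr0 : 0 < r) (hrn : r < n) (hqr : r + 1 ≤ q)
    (M : Submodule F (LinearMap.BilinForm F V))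
    (hM : Module.finrank F M = 2 * n)
    (hrank : ∀ f ∈ M, f ≠ 0 → bilRank f = r ∨ bilRank f = n) :
    (n - r) ∣ n ∧
      (Set.ncard {f : LinearMap.BilinForm F V | f ∈ M ∧ bilRank f = r} : ℚ) =
        ((q : ℚ) ^ n - 1) ^ 2 / ((q : ℚ) ^ (n - r) - 1) := by
  simp only [bilRank_eq_finrank_range] at hrank ⊢
  simpa only [or_self, sq] using mainTheorem2_general q n n r hq hn
    (Subspace.dual_finrank_eq.trans hn) le_rfl hr0 hrn hqr M hM.ge hrank
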